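/- Let $\mathbb F_q$ be a finite field with $q$ elements and characteristic $p$, let $n,m\ge 0$ be integers and let $\alpha\in\mathbb F_q$. For $i\ge 1$ let $I_i$ be the set of monic irreducible polynomials of degree $i$ over $\mathbb F_q$, and put $$a_i=\frac1{iq}\sum_{k\mid i,\ p\nmid k}\mu(k)q^{i/k},\qquad b_i=\frac1i\sum_{k\mid i,\ p\mid k}\mu(k)q^{i/k}.$$ For $l\ge 0$ put $$B_l(a,0)=\begin{cases}\binom{aq/p+l/p-1}{l/p}&\text{if }p\mid l,\\ 0&\text{otherwise,}\end{cases}\qquad B_l(a,b)=\sum_{j=0}^{\lfloor l/p\rfloor}\binom{aq/p+j-1}{j}\binom{b+l-pj-1}{l-pj}\quad(b\ne0),$$ where $\binom{x}{k}=x(x-1)\cdots(x-k+1)/k!$ (the upper entry may be negative). Let $v(\alpha)=q-1$ if $\alpha=0$ and $v(\alpha)=-1$ otherwise. For a monic polynomial $f$ let $\langle f\rangle=x^{\deg f}f(1/x)\bmod x^2$. For $l_1,\dots,l_n\ge0$ let $N^*(m,\prod_{i=1}^nI_i^{l_i},\langle x+\alpha\rangle)$ be the number of monic polynomials $g$ of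 degree $m$ over $\mathbb F_q$ with $\langle g\rangle=\langle x+\alpha\rangle$ that have, for each $1\le i\le n$, exactly $l_i$ monic irreducible factors of degree $i$, counted with multiplicity. Call a polynomial $n$-smooth if all its irreducible factors have degree at most $n$. Then $$\sum_{l_1+2l_2+\cdots+nl_n=m}N^*\Big(m,\prod_{i=1}^nI_i^{l_i},\langle x+\alpha\rangle\Big)=\frac1q\sum_{l_1+2l_2+\cdots+nl_n=m}\ \prod_{i=1}^n\binom{|I_i|+l_i-1}{l_i}+\frac{v(\alpha)}q\sum_{l_1+2l_2+\cdots+nl_n=m}\ \prod_{i=1}^nB_{l_i}(a_i,b_i),$$ where all sums run over tuples of non-negative integers $(l_1,\dots,l_n)$. Moreover, if $m\ge1$, this number is the number of $n$-smooth polynomials of the form $x^m+\alpha x^{m-1}+g(x)$ with $g\in\mathbb F_q[x]$ of degree at most $m-2$ ($g=0$ if $m=1$). -/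

import Mathlib

open Polynomial

noncomputable section

/-- `I_i`: the set of monic irreducible polynomials of degree `i` over `F`. -/
def monicIrreducibles (F : Type*) [Field F] (i : ℕ) : Set F[X] :=
  {g | g.Monic ∧ Irreducible g ∧ g.natDegree = i}

/-- `l_i(f)`: the number of monic irreducible factors of degree `i` of `f`, counted with
multiplicity, i.e. the sum over `g ∈ I_i` of the largest `k` with `g ^ k ∣ f`. -/
def irreducibleFactorCount {F : Type*} [Field F] (i : ℕ) (f : F[X]) : ℕ :=
  ∑ᶠ g ∈ monicIrreducibles F i, multiplicity g f

/-- `⟨f⟩_w`: the class of `x ^ (deg f) * f (1 / x)` modulo `x ^ (w + 1)`.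
`Polynomial.reverse f` is the polynomial `x ^ (deg f) * f (1 / x)`. -/
def leadingClass {F : Type*} [Field F] (w : ℕ) (f : F[X]) :
    F[X] ⧸ Ideal.span {(X : F[X]) ^ (w + 1)} :=
  Ideal.Quotient.mk _ f.reverse

/-- `N^*(m, ∏_{i ∈ T} I_i ^ {l_i}, ⟨f⟩_w)`: the number of monic polynomials `g` of degree `m`
with `⟨g⟩_w = ⟨f⟩_w` that have, for each `i ∈ T`, exactly `l i` monic irreducible factors of
degree `i`, counted with multiplicity. -/
def factorPatternCount {F : Type*} [Field F] (m : ℕ) {T : Finset ℕ} (l : T → ℕ) (w : ℕ)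
    (f : F[X]) : ℕ :=
  {g : F[X] | g.Monic ∧ g.natDegree = m ∧ leadingClass w g = leadingClass w f ∧
    ∀ i : T, irreducibleFactorCount i g = l i}.ncard

/-- `f` is `n`-smooth: all its irreducible factors have degree at most `n`. -/
def IsSmoothPoly {F : Type*} [Field F] (n : ℕ) (f : F[X]) : Prop :=
  ∀ g : F[X], Irreducible g → g ∣ f → g.natDegree ≤ n

/-- The tuples `(l_1, …, l_n)` of natural numbers with `∑ i * l_i = m`. -/
def weightedTuples (n m : ℕ) : Finset (Finset.Icc 1 n → ℕ) :=
  (Fintype.piFinset fun _ => Finset.range (m + 1)).filter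
    fun l => ∑ i : Finset.Icc 1 n, (i : ℕ) * l i = m

theorem mem_weightedTuples {n m : ℕ} {l : Finset.Icc 1 n → ℕ} :
    l ∈ weightedTuples n m ↔ ∑ i : Finset.Icc 1 n, (i : ℕ) * l i = m := by
  simp only [weightedTuples, Finset.mem_filter, Fintype.mem_piFinset, Finset.mem_range,
    and_iff_right_iff_imp]
  intro h i
  have hi : 1 ≤ (i : ℕ) := (Finset.mem_Icc.1 i.2).1
  have h1 : (i : ℕ) * l i ≤ m :=
    h ▸ Finset.single_le_sum (f := fun i : Finset.Icc 1 n => (i : ℕ) * l i)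
      (fun _ _ => Nat.zero_le _) (Finset.mem_univ i)
  nlinarith

/-- `a_i = (1 / (i q)) ∑_{k ∣ i, p ∤ k} μ(k) q ^ (i / k)`. -/
def traceA (p q i : ℕ) : ℚ :=
  1 / ((i : ℚ) * q) *
    ∑ k ∈ i.divisors.filter (fun k => ¬ p ∣ k),
      (ArithmeticFunction.moebius k : ℚ) * (q : ℚ) ^ (i / k)

/-- `b_i = (1 / i) ∑_{k ∣ i, p ∣ k} μ(k) q ^ (i / k)`. -/
def traceB (p q i : ℕ) : ℚ :=
  1 / (i : ℚ) *
    ∑ k ∈ i.divisors.filter (fun k => p ∣ k),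
      (ArithmeticFunction.moebius k : ℚ) * (q : ℚ) ^ (i / k)

/-- The numbers `B_m(a, b)`. The binomial coefficients are the generalized ones,
`Ring.choose x k = x (x - 1) ⋯ (x - k + 1) / k!`; the upper entry may be negative. -/
def coeffB (p q m : ℕ) (a b : ℚ) : ℚ :=
  if b = 0 then
    if p ∣ m then Ring.choose (a * q / p + (m / p : ℕ) - 1) (m / p) else 0
  else
    ∑ j ∈ Finset.range (m / p + 1),
      Ring.choose (a * q / p + j - 1) j *
        Ring.choose (b + (m - p * j : ℕ) - 1) (m - p * j)

open Classical in
/-- `v(α) = q ⟦α = 0⟧ - 1`, where `q = |F|`. -/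
def traceV {F : Type*} [Field F] (α : F) : ℚ :=
  (if α = 0 then (Nat.card F : ℚ) else 0) - 1

end

noncomputable section

/-! For monic `g` the class modulo x² records exactly `g.nextCoeff`, so orthogonality of the
additive characters `χ` of `F` writes q·N* as the sum over `χ` of `χ (-α)` times the sum of `χ
g.nextCoeff` over all `g` with the given pattern (`natCard_mul_factorPatternCount`). On products of
monic polynomials `nextCoeff` is additive, so unique factorization turns the inner sum into a
product over i of the coefficient of X^{l_i} in ∏_{f ∈ I_i} 1/(1 - χ(f.nextCoeff) X)
(`sum_factorPatternFinset_addChar`).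

The trivial character gives (1 - X)^{-|I_i|}, hence the ordinary binomials. For nontrivial `χ` the
factors are grouped by c = `f.nextCoeff`: there are a_i of them for each c ≠ 0 and a_i + b_i for c =
0. Since ∏_c (1 - χ(c) X) = (1 - X^p)^{q/p}, the series is (1 - X^p)^{-a_i q/p} (1 - X)^{-b_i},
whose coefficients are the B_l(a_i, b_i). They do not depend on `χ`, so the remaining sum of `χ
(-α)` over χ ≠ 0 supplies v(α).

The counts a_i and b_i come from equidistribution of the trace on the degree i extension, sorted by
minimal polynomials and inverted. -/

/-! ### Monic irreducible factors and smoothness. -/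

theorem finite_setOf_natDegree_le {F : Type*} [Field F] [Finite F] (m : ℕ) :
    {g : F[X] | g.natDegree ≤ m}.Finite := by
  refine Set.Finite.of_finite_image (f := fun g : F[X] => fun i : Fin (m + 1) => g.coeff i)
    (Set.toFinite _) ?_
  intro g hg h hh e
  ext k
  rcases lt_or_ge k (m + 1) with hk | hk
  · exact congrFun e ⟨k, hk⟩
  · rw [coeff_eq_zero_of_natDegree_lt (lt_of_le_of_lt hg hk),
      coeff_eq_zero_of_natDegree_lt (lt_of_le_of_lt hh hk)]

theorem monicIrreducibles_finite (F : Type*) [Field F] [Finite F] (i : ℕ) :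
    (monicIrreducibles F i).Finite :=
  (finite_setOf_natDegree_le (F := F) i).subset fun _ hg => hg.2.2.le

/-- The monic irreducible polynomials of degree `i` as a finset. -/
def monicIrreduciblesFinset (F : Type*) [Field F] [Finite F] (i : ℕ) : Finset F[X] :=
  (monicIrreducibles_finite F i).toFinset

theorem mem_monicIrreduciblesFinset {F : Type*} [Field F] [Finite F] {i : ℕ} {f : F[X]} :
    f ∈ monicIrreduciblesFinset F i ↔ f.Monic ∧ Irreducible f ∧ f.natDegree = i := by
  simp [monicIrreduciblesFinset, monicIrreducibles]

theorem ncard_monicIrreducibles (F : Type*) [Field F] [Finite F] (i : ℕ) :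
    (monicIrreducibles F i).ncard = (monicIrreduciblesFinset F i).card :=
  Set.ncard_eq_toFinset_card _ _

open Classical in
/-- The multiset of monic irreducible factors of a polynomial over a field. -/
def monicFactors {F : Type*} [Field F] (g : F[X]) : Multiset F[X] :=
  UniqueFactorizationMonoid.normalizedFactors g

section MonicFactors

variable {F : Type*} [Field F]

theorem mem_monicFactors {f g : F[X]} (hg : g ≠ 0) :
    f ∈ monicFactors g ↔ f.Monic ∧ Irreducible f ∧ f ∣ g := by
  classical
  rw [monicFactors, UniqueFactorizationMonoid.mem_normalizedFactors_iff' hg]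
  constructor
  · rintro ⟨h1, h2, h3⟩
    exact ⟨(normalize_eq_self_iff_monic h1.ne_zero).1 h2, h1, h3⟩
  · rintro ⟨h1, h2, h3⟩
    exact ⟨h2, (normalize_eq_self_iff_monic h2.ne_zero).2 h1, h3⟩

theorem prod_monicFactors {g : F[X]} (hg : g.Monic) : (monicFactors g).prod = g := by
  classical
  rw [monicFactors, UniqueFactorizationMonoid.prod_normalizedFactors_eq hg.ne_zero]
  exact (normalize_eq_self_iff_monic hg.ne_zero).2 hg

theorem monicFactors_prod {M : Multiset F[X]} (hM : ∀ f ∈ M, f.Monic ∧ Irreducible f) :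
    monicFactors M.prod = M := by
  classical
  rw [monicFactors, UniqueFactorizationMonoid.normalizedFactors_prod_eq _ fun f hf => (hM f hf).2]
  conv_rhs => rw [← Multiset.map_id M]
  exact Multiset.map_congr rfl fun f hf =>
    (normalize_eq_self_iff_monic (hM f hf).2.ne_zero).2 (hM f hf).1

open Classical in
theorem multiplicity_eq_count_monicFactors {f g : F[X]} (hf : f.Monic) (hi : Irreducible f)
    (hg : g ≠ 0) : multiplicity f g = (monicFactors g).count f := by
  rw [monicFactors, UniqueFactorizationMonoid.multiplicity_eq_count_normalizedFactors hi hg,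
    (normalize_eq_self_iff_monic hi.ne_zero).2 hf]

theorem irreducibleFactorCount_eq_card_filter [Finite F] {g : F[X]} (hg : g ≠ 0) (i : ℕ) :
    irreducibleFactorCount i g = ((monicFactors g).filter fun f => f.natDegree = i).card := by
  classical
  have h1 : irreducibleFactorCount i g =
      ∑ f ∈ monicIrreduciblesFinset F i, multiplicity f g := by
    rw [irreducibleFactorCount]
    exact finsum_mem_eq_finite_toFinset_sum _ (monicIrreducibles_finite F i)
  rw [h1, ← Multiset.sum_count_eq_card (s := monicIrreduciblesFinset F i)]
  · refine Finset.sum_congr rfl fun f hf => ?_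
    rw [mem_monicIrreduciblesFinset] at hf
    rw [multiplicity_eq_count_monicFactors hf.1 hf.2.1 hg,
      Multiset.count_filter_of_pos (p := fun f : F[X] => f.natDegree = i) hf.2.2]
  · intro f hf
    rw [Multiset.mem_filter, mem_monicFactors hg] at hf
    exact mem_monicIrreduciblesFinset.2 ⟨hf.1.1, hf.1.2.1, hf.2⟩

theorem sum_natDegree_monicFactors {g : F[X]} (hg : g.Monic) :
    ((monicFactors g).map natDegree).sum = g.natDegree := by
  conv_rhs => rw [← prod_monicFactors hg]
  rw [natDegree_multiset_prod_of_monic]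
  intro f hf
  exact ((mem_monicFactors hg.ne_zero).1 hf).1

theorem natDegree_pos_of_mem_monicFactors {f g : F[X]} (hg : g ≠ 0) (hf : f ∈ monicFactors g) :
    0 < f.natDegree :=
  ((mem_monicFactors hg).1 hf).2.1.natDegree_pos

theorem isSmoothPoly_iff_monicFactors {n : ℕ} {g : F[X]} (hg : g ≠ 0) :
    IsSmoothPoly n g ↔ ∀ f ∈ monicFactors g, f.natDegree ≤ n := by
  classical
  constructor
  · intro h f hf
    rw [mem_monicFactors hg] at hf
    exact h f hf.2.1 hf.2.2
  · intro h f hf hfg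
    have := h (normalize f) ((mem_monicFactors hg).2 ⟨monic_normalize hf.ne_zero,
      (associated_normalize f).irreducible hf, (normalize_dvd_iff).2 hfg⟩)
    rwa [natDegree_eq_of_degree_eq degree_normalize] at this

end MonicFactors

theorem sum_mul_card_filter_eq {α : Type*} (d : α → ℕ) (n : ℕ) (M : Multiset α)
    (hM : ∀ f ∈ M, 0 < d f) :
    ∑ i : Finset.Icc 1 n, (i : ℕ) * (M.filter fun f => d f = i).card =
      ((M.filter fun f => d f ≤ n).map d).sum := by
  rw [Finset.sum_coe_sort (Finset.Icc 1 n) fun i => i * (M.filter fun f => d f = i).card]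
  induction M using Multiset.induction_on with
  | empty => simp
  | cons a M ih =>
    have ih' := ih fun f hf => hM f (Multiset.mem_cons_of_mem hf)
    have ha := hM a (Multiset.mem_cons_self a M)
    have h1 : ∀ i : ℕ, i * ((a ::ₘ M).filter fun f => d f = i).card =
        (if d a = i then i else 0) + i * (M.filter fun f => d f = i).card := by
      intro i
      by_cases h : d a = i
      · rw [Multiset.filter_cons_of_pos (p := fun f => d f = i) _ h, Multiset.card_cons, if_pos h]; ring
      · rw [Multiset.filter_cons_of_neg (p := fun f => d f = i) _ h, if_neg h]; ring
    simp_rw [h1]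
    rw [Finset.sum_add_distrib, ih', Finset.sum_ite_eq]
    by_cases h : d a ≤ n
    · rw [if_pos (Finset.mem_Icc.2 ⟨ha, h⟩),
        Multiset.filter_cons_of_pos (p := fun f => d f ≤ n) _ h, Multiset.map_cons, Multiset.sum_cons]
    · rw [if_neg (fun hh => h (Finset.mem_Icc.1 hh).2),
        Multiset.filter_cons_of_neg (p := fun f => d f ≤ n) _ h, zero_add]

/-- The degrees of all factors add up to `g.natDegree`, and the sum sees only those of degree at
most `n`. Equality leaves total degree 0 for the others, and factors have positive degree, so there
are none. -/
theorem isSmoothPoly_iff_sum_irreducibleFactorCount {F : Type*} [Field F] [Finite F] {n : ℕ}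
    {g : F[X]} (hg : g.Monic) :
    IsSmoothPoly n g ↔
      ∑ i : Finset.Icc 1 n, (i : ℕ) * irreducibleFactorCount i g = g.natDegree := by
  simp_rw [irreducibleFactorCount_eq_card_filter hg.ne_zero]
  rw [sum_mul_card_filter_eq natDegree n _
    fun f hf => natDegree_pos_of_mem_monicFactors hg.ne_zero hf,
    isSmoothPoly_iff_monicFactors hg.ne_zero, ← sum_natDegree_monicFactors hg]
  constructor
  · intro h
    rw [Multiset.filter_eq_self.2 h]
  · intro h
    have h2 := congrArg (fun M => (M.map natDegree).sum)
      (Multiset.filter_add_not (fun f : F[X] => f.natDegree ≤ n) (monicFactors g))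
    simp only [Multiset.map_add, Multiset.sum_add, h] at h2
    have h3 : (((monicFactors g).filter fun f => ¬ f.natDegree ≤ n).map natDegree).sum = 0 := by
      omega
    intro f hf
    by_contra hfn
    have h4 := Multiset.single_le_sum (fun _ _ => Nat.zero_le _) f.natDegree
      (Multiset.mem_map_of_mem natDegree
        (Multiset.mem_filter (p := fun f : F[X] => ¬ f.natDegree ≤ n).2 ⟨hf, hfn⟩))
    omega

/-! ### The second coefficient and the leading class. -/

theorem leadingClass_one_eq_iff {F : Type*} [Field F] (g : F[X]) (hg : g.Monic) (α : F) :
    leadingClass 1 g = leadingClass 1 (X + C α) ↔ g.nextCoeff = α := by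
  rw [leadingClass, leadingClass, Ideal.Quotient.eq, Ideal.mem_span_singleton, X_pow_dvd_iff]
  have h0 : (g.reverse - (X + C α).reverse).coeff 0 = 0 := by
    rw [coeff_sub, coeff_zero_reverse, coeff_zero_reverse, hg.leadingCoeff,
      (monic_X_add_C α).leadingCoeff, sub_self]
  have h1 : (g.reverse - (X + C α).reverse).coeff 1 = g.nextCoeff - α := by
    rw [coeff_sub, coeff_one_reverse, coeff_one_reverse, nextCoeff_X_add_C]
  constructor
  · intro h
    have := h 1 (by norm_num)
    rwa [h1, sub_eq_zero] at this
  · intro h d hd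
    interval_cases d
    · exact h0
    · rw [h1, h, sub_self]

/-- The bound on the degree is strict and in `WithBot ℕ`, so for `m = 1` it forces `g = 0`. -/
theorem exists_add_iff_monic {F : Type*} [Field F] {m : ℕ} (hm : 1 ≤ m) (α : F) (f : F[X]) :
    (∃ g : F[X], g.degree < ((m - 1 : ℕ) : WithBot ℕ) ∧ f = X ^ m + C α * X ^ (m - 1) + g) ↔
      f.Monic ∧ f.natDegree = m ∧ f.nextCoeff = α := by
  obtain ⟨k, rfl⟩ : ∃ k, m = k + 1 := ⟨m - 1, by omega⟩
  simp only [Nat.add_sub_cancel]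
  constructor
  · rintro ⟨g, hg, rfl⟩
    have h1 : (C α * X ^ k + g).degree < ((k + 1 : ℕ) : WithBot ℕ) := by
      refine lt_of_le_of_lt (degree_add_le _ _) (max_lt ?_ (hg.trans ?_))
      · exact lt_of_le_of_lt (degree_C_mul_X_pow_le _ _) (by exact_mod_cast Nat.lt_succ_self k)
      · exact_mod_cast Nat.lt_succ_self k
    rw [add_assoc]
    have h2 : (X ^ (k + 1) + (C α * X ^ k + g)).natDegree = k + 1 :=
      natDegree_eq_of_degree_eq_some (by
        rw [degree_add_eq_left_of_degree_lt (by rwa [degree_X_pow]), degree_X_pow])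
    refine ⟨monic_X_pow_add h1, h2, ?_⟩
    rw [nextCoeff_of_natDegree_pos (by omega), h2, Nat.add_sub_cancel, coeff_add, coeff_add,
      coeff_X_pow, coeff_C_mul_X_pow, coeff_eq_zero_of_degree_lt hg]
    simp
  · rintro ⟨h1, h2, h3⟩
    refine ⟨f - (X ^ (k + 1) + C α * X ^ k), ?_, by ring⟩
    rw [degree_lt_iff_coeff_zero]
    intro j hj
    rw [nextCoeff_of_natDegree_pos (by omega), h2, Nat.add_sub_cancel] at h3
    rw [coeff_sub, coeff_add, coeff_X_pow, coeff_C_mul_X_pow]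
    rcases lt_trichotomy j (k + 1) with h | h | h
    · obtain rfl : j = k := by omega
      simp [h3]
    · subst h
      have := h1.coeff_natDegree
      rw [h2] at this
      simp [this]
    · rw [coeff_eq_zero_of_natDegree_lt (by omega)]
      rw [if_neg (by omega), if_neg (by omega)]; simp

/-! ### Smooth polynomials sorted by factorization pattern. -/

/-- The monic polynomials of degree `m` with a given number of irreducible factors of each
degree `i ∈ T`. -/
def factorPatternFinset (F : Type*) [Field F] [Finite F] (m : ℕ) {T : Finset ℕ} (l : T → ℕ) :
    Finset F[X] :=
  Set.Finite.toFinset (s := {g : F[X] | g.Monic ∧ g.natDegree = m ∧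
    ∀ i : T, irreducibleFactorCount i g = l i})
    ((finite_setOf_natDegree_le (F := F) m).subset fun _ hg => hg.2.1.le)

theorem mem_factorPatternFinset {F : Type*} [Field F] [Finite F] {m : ℕ} {T : Finset ℕ}
    {l : T → ℕ} {g : F[X]} :
    g ∈ factorPatternFinset F m l ↔ g.Monic ∧ g.natDegree = m ∧
      ∀ i : T, irreducibleFactorCount i g = l i := by
  simp [factorPatternFinset]

open Classical in
theorem factorPatternCount_one_eq_card {F : Type*} [Field F] [Finite F] (m : ℕ) {T : Finset ℕ}
    (l : T → ℕ) (α : F) :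
    factorPatternCount m l 1 (X + C α) =
      ((factorPatternFinset F m l).filter fun g => g.nextCoeff = α).card := by
  rw [factorPatternCount, ← Set.ncard_coe_finset]
  congr 1
  ext g
  simp only [Set.mem_ofPred_eq, Finset.coe_filter, mem_factorPatternFinset]
  constructor
  · rintro ⟨h1, h2, h3, h4⟩
    exact ⟨⟨h1, h2, h4⟩, (leadingClass_one_eq_iff g h1 α).1 h3⟩
  · rintro ⟨⟨h1, h2, h4⟩, h3⟩
    exact ⟨h1, h2, (leadingClass_one_eq_iff g h1 α).2 h3, h4⟩

theorem ncard_smooth_eq_sum_factorPatternCount {F : Type*} [Field F] [Finite F] {m : ℕ}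
    (hm : 1 ≤ m) (n : ℕ) (α : F) :
    {f : F[X] | (∃ g : F[X], g.degree < ((m - 1 : ℕ) : WithBot ℕ) ∧
      f = X ^ m + C α * X ^ (m - 1) + g) ∧ IsSmoothPoly n f}.ncard =
        ∑ l ∈ weightedTuples n m, factorPatternCount m l 1 (X + C α) := by
  classical
  simp_rw [exists_add_iff_monic hm, factorPatternCount_one_eq_card]
  have hfin : {f : F[X] | (f.Monic ∧ f.natDegree = m ∧ f.nextCoeff = α) ∧
      IsSmoothPoly n f}.Finite :=
    (finite_setOf_natDegree_le (F := F) m).subset fun _ hg => hg.1.2.1.le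
  rw [Set.ncard_eq_toFinset_card _ hfin,
    Finset.card_eq_sum_card_fiberwise (t := weightedTuples n m)
      (f := fun f => fun i : Finset.Icc 1 n => irreducibleFactorCount (i : ℕ) f)]
  · refine Finset.sum_congr rfl fun l hl => ?_
    congr 1
    ext f
    simp only [Finset.mem_filter, Set.Finite.mem_toFinset, Set.mem_ofPred_eq,
      mem_factorPatternFinset]
    constructor
    · rintro ⟨⟨⟨h1, h2, h3⟩, h4⟩, rfl⟩
      exact ⟨⟨h1, h2, fun _ => rfl⟩, h3⟩
    · rintro ⟨⟨h1, h2, h4⟩, h3⟩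
      refine ⟨⟨⟨h1, h2, h3⟩, ?_⟩, funext h4⟩
      rw [isSmoothPoly_iff_sum_irreducibleFactorCount h1]
      simp_rw [h4]
      rw [mem_weightedTuples.1 hl, h2]
  · intro f hf
    simp only [Set.Finite.coe_toFinset, Set.mem_ofPred_eq] at hf
    simp only [Finset.mem_coe, mem_weightedTuples]
    rw [(isSmoothPoly_iff_sum_irreducibleFactorCount hf.1.1).1 hf.2, hf.1.2.1]

/-! ### Geometric and binomial power series. -/

/-- The geometric series `1 / (1 - x X)`. -/
def geomSeries (x : ℂ) : PowerSeries ℂ := PowerSeries.mk fun n => x ^ n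

theorem one_sub_mul_geomSeries (x : ℂ) :
    (1 - PowerSeries.C x * PowerSeries.X) * geomSeries x = 1 := by
  ext n
  rw [sub_mul, one_mul, map_sub, mul_assoc, PowerSeries.coeff_C_mul]
  cases n with
  | zero => simp [geomSeries]
  | succ n =>
    rw [PowerSeries.coeff_succ_X_mul, geomSeries, PowerSeries.coeff_mk, PowerSeries.coeff_mk,
      PowerSeries.coeff_one, if_neg (by omega)]
    ring

/-- The binomial series `(1 - X) ^ (-r)`. -/
def negBinomialSeries (r : ℚ) : PowerSeries ℂ :=
  PowerSeries.rescale (-1) (PowerSeries.binomialSeries ℂ (-r))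

theorem coeff_negBinomialSeries (r : ℚ) (n : ℕ) :
    PowerSeries.coeff n (negBinomialSeries r) = ((Ring.choose (r + n - 1) n : ℚ) : ℂ) := by
  rw [negBinomialSeries, PowerSeries.coeff_rescale, PowerSeries.binomialSeries_coeff,
    Ring.choose_neg]
  rw [Units.smul_def, zsmul_eq_mul, Rat.smul_def, mul_one, Int.cast_negOnePow_natCast]
  push_cast
  rw [← mul_assoc, ← mul_pow]
  norm_num

theorem negBinomialSeries_add (r s : ℚ) :
    negBinomialSeries (r + s) = negBinomialSeries r * negBinomialSeries s := by
  rw [negBinomialSeries, neg_add, PowerSeries.binomialSeries_add, map_mul]; rfl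

theorem negBinomialSeries_zero : negBinomialSeries 0 = 1 := by
  rw [negBinomialSeries, neg_zero, PowerSeries.binomialSeries_zero, map_one]

theorem negBinomialSeries_one : negBinomialSeries 1 = geomSeries 1 := by
  ext n
  rw [coeff_negBinomialSeries, geomSeries, PowerSeries.coeff_mk, add_sub_cancel_left,
    Ring.choose_natCast]
  simp

theorem geomSeries_one_pow (k : ℕ) : geomSeries 1 ^ k = negBinomialSeries k := by
  induction k with
  | zero => rw [pow_zero, Nat.cast_zero, negBinomialSeries_zero]
  | succ k ih => rw [pow_succ, ih, Nat.cast_succ, negBinomialSeries_add, negBinomialSeries_one]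

theorem coeff_expand_mul_negBinomialSeries {p : ℕ} (hp : p ≠ 0) (q l : ℕ) (a b : ℚ) :
    PowerSeries.coeff l (PowerSeries.expand p hp (negBinomialSeries (a * q / p)) *
      negBinomialSeries b) = ((coeffB p q l a b : ℚ) : ℂ) := by
  by_cases hb : b = 0
  · rw [hb, negBinomialSeries_zero, mul_one, coeffB, if_pos rfl, PowerSeries.coeff_expand]
    split_ifs with h
    · rw [coeff_negBinomialSeries]
    · simp
  · rw [coeffB, if_neg hb, PowerSeries.coeff_mul]
    push_cast
    symm
    -- Only antidiagonal pairs with first entry `p * j` matter: the expanded series has no other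
    -- exponents.
    refine Finset.sum_of_injOn (fun j => (p * j, l - p * j)) ?_ ?_ ?_ ?_
    · intro j _ k _ h
      exact Nat.eq_of_mul_eq_mul_left (Nat.pos_of_ne_zero hp) (Prod.ext_iff.1 h).1
    · intro j hj
      have hj' : j < l / p + 1 := by simpa using hj
      have : p * j ≤ l := by
        rw [mul_comm]; exact (Nat.le_div_iff_mul_le (Nat.pos_of_ne_zero hp)).1 (by omega)
      simp only [Finset.mem_coe, Finset.HasAntidiagonal.mem_antidiagonal]
      omega
    · rintro ⟨u, v⟩ huv hn
      rw [Finset.HasAntidiagonal.mem_antidiagonal] at huv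
      rw [PowerSeries.coeff_expand, if_neg, zero_mul]
      rintro ⟨j, hj⟩
      apply hn
      simp only at huv hj
      refine ⟨j, ?_, ?_⟩
      · have : j ≤ l / p := (Nat.le_div_iff_mul_le (Nat.pos_of_ne_zero hp)).2 (by
          rw [mul_comm]; omega)
        simpa using Nat.lt_succ_of_le this
      · ext <;> simp <;> omega
    · intro j _
      rw [PowerSeries.coeff_expand_mul, coeff_negBinomialSeries, coeff_negBinomialSeries]

/-! ### Products over the values of an additive character. -/

/-- The product of `1 - χ(c) X` over a finite field for a nontrivial additive character `χ`. -/
theorem prod_one_sub_addChar {F : Type*} [Field F] [Fintype F] (p : ℕ) [hp : Fact p.Prime]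
    [CharP F p] {χ : AddChar F ℂ} (hχ : χ ≠ 0) {k : ℕ} (hk : Fintype.card F = p * k) :
    ∏ c : F, (1 - PowerSeries.C (χ c) * PowerSeries.X) = (1 - PowerSeries.X ^ p) ^ k := by
  have hpow : ∀ c, χ c ^ p = 1 := fun c => by
    rw [← AddChar.map_nsmul_eq_pow, nsmul_eq_mul, CharP.cast_eq_zero, zero_mul,
      AddChar.map_zero_eq_one]
  obtain ⟨c₀, hc₀⟩ := AddChar.ne_zero_iff.1 hχ
  have hζ : IsPrimitiveRoot (χ c₀) p := by
    have := IsPrimitiveRoot.orderOf (χ c₀)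
    rwa [orderOf_eq_prime (hpow c₀) hc₀] at this
  have hζ' : IsPrimitiveRoot (PowerSeries.C (χ c₀)) p :=
    hζ.map_of_injective PowerSeries.C_injective
  -- Along the translates of `c` by multiples of `c₀` the values of `χ` are χ(c) times all p-th
  -- roots of unity; this is the factorization of 1 - Y^p at Y = χ(c) X, with χ(c)^p = 1.
  have h1 : ∀ c, ∏ j ∈ Finset.range p, (1 - PowerSeries.C (χ (j • c₀ + c)) * PowerSeries.X) =
      (1 : PowerSeries ℂ) - PowerSeries.X ^ p := by
    intro c
    have := hζ'.pow_sub_pow_eq_prod_sub_mul (1 : PowerSeries ℂ)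
      (PowerSeries.C (χ c) * PowerSeries.X) hp.out.pos
    rw [one_pow, mul_pow, ← map_pow, hpow, map_one, one_mul] at this
    rw [this]
    refine Finset.prod_nbij (fun j => PowerSeries.C (χ c₀) ^ j) ?_ ?_ ?_ ?_
    · intro j _
      rw [mem_nthRootsFinset hp.out.pos, ← pow_mul, mul_comm, pow_mul, hζ'.pow_eq_one, one_pow]
    · intro j hj k hk h
      exact hζ'.pow_inj (by simpa using hj) (by simpa using hk) h
    · intro z hz
      have hz' : z ^ p = 1 := (mem_nthRootsFinset hp.out.pos _).1 hz
      have : NeZero p := ⟨hp.out.ne_zero⟩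
      obtain ⟨j, hj, rfl⟩ := hζ'.eq_pow_of_pow_eq_one hz'
      exact ⟨j, by simpa using hj, rfl⟩
    · intro j _
      rw [AddChar.map_add_eq_mul, AddChar.map_nsmul_eq_pow, map_mul, map_pow, mul_assoc]
  set P : PowerSeries ℂ := ∏ c : F, (1 - PowerSeries.C (χ c) * PowerSeries.X) with hP
  set Q : PowerSeries ℂ := (1 - PowerSeries.X ^ p) ^ k with hQ
  -- Translating each of `p` copies of `P` by a different multiple of `c₀` and exchanging the
  -- products avoids a choice of coset representatives.
  have h2 : P ^ p = Q ^ p := by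
    calc P ^ p = ∏ j ∈ Finset.range p, P := by rw [Finset.prod_const, Finset.card_range]
      _ = ∏ j ∈ Finset.range p, ∏ c : F,
          (1 - PowerSeries.C (χ (j • c₀ + c)) * PowerSeries.X) := by
        refine Finset.prod_congr rfl fun j _ => ?_
        exact (Fintype.prod_equiv (Equiv.addLeft (j • c₀)) _
          (fun c => 1 - PowerSeries.C (χ c) * PowerSeries.X) fun _ => rfl).symm
      _ = ∏ c : F, ((1 : PowerSeries ℂ) - PowerSeries.X ^ p) := by
        rw [Finset.prod_comm]
        exact Finset.prod_congr rfl fun c _ => h1 c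
      _ = Q ^ p := by
        rw [Finset.prod_const, Finset.card_univ, hk, hQ, ← pow_mul, mul_comm]
  have hP0 : PowerSeries.constantCoeff P = 1 := by
    rw [hP, map_prod]
    exact Finset.prod_eq_one fun c _ => by simp
  have hQ0 : PowerSeries.constantCoeff Q = 1 := by
    rw [hQ]
    simp [hp.out.ne_zero]
  -- The cofactor of `P - Q` in `P ^ p - Q ^ p` has constant coefficient `p ≠ 0`, so it can be
  -- cancelled.
  have h3 := geom_sum₂_mul P Q p
  rw [h2, sub_self] at h3
  refine sub_eq_zero.1 ((mul_eq_zero.1 h3).resolve_left fun h4 => ?_)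
  have h5 := congrArg PowerSeries.constantCoeff h4
  simp [hP0, hQ0, hp.out.ne_zero] at h5

/-- The product of the geometric series with ratios `χ(c)`, for a nontrivial additive
character `χ` of a finite field. -/
theorem prod_geomSeries_addChar {F : Type*} [Field F] [Fintype F] (p : ℕ) [hp : Fact p.Prime]
    [CharP F p] {χ : AddChar F ℂ} (hχ : χ ≠ 0) {k : ℕ} (hk : Fintype.card F = p * k) :
    ∏ c : F, geomSeries (χ c) =
      PowerSeries.expand p hp.out.ne_zero (negBinomialSeries k) := by
  have h1 : (1 - PowerSeries.X ^ p) ^ k * ∏ c : F, geomSeries (χ c) = 1 := by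
    rw [← prod_one_sub_addChar p hχ hk, ← Finset.prod_mul_distrib]
    exact Finset.prod_eq_one fun c _ => one_sub_mul_geomSeries _
  have h2 : (1 - PowerSeries.X ^ p) ^ k *
      PowerSeries.expand p hp.out.ne_zero (negBinomialSeries k) = 1 := by
    have h3 : (1 : PowerSeries ℂ) - PowerSeries.X ^ p =
        PowerSeries.expand p hp.out.ne_zero (1 - PowerSeries.C (1 : ℂ) * PowerSeries.X) := by
      simp
    rw [h3, ← geomSeries_one_pow, map_pow, ← mul_pow, ← map_mul, one_sub_mul_geomSeries,
      map_one, one_pow]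
  have h4 : ((1 : PowerSeries ℂ) - PowerSeries.X ^ p) ^ k ≠ 0 := left_ne_zero_of_mul_eq_one h1
  exact mul_left_cancel₀ h4 (h1.trans h2.symm)

/-! ### Möbius inversion away from `p`. -/

/-- The arithmetic function that is `0` at the multiples of `p` and `1` elsewhere. -/
def coprimeIndicator (p : ℕ) : ArithmeticFunction ℚ :=
  ⟨fun k => if p ∣ k then 0 else 1, by simp⟩

theorem coprimeIndicator_apply (p k : ℕ) :
    coprimeIndicator p k = if p ∣ k then 0 else 1 := rfl

/-- The indicator is completely multiplicative, so multiplying by it pointwise respects Dirichlet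
convolution and carries ζ * μ = 1 to this identity. -/
theorem coprimeIndicator_mul_moebius {p : ℕ} (hp : p.Prime) :
    coprimeIndicator p * (coprimeIndicator p).pmul ((ArithmeticFunction.moebius :
      ArithmeticFunction ℤ) : ArithmeticFunction ℚ) = 1 := by
  ext n
  have h1 := congrArg (fun f : ArithmeticFunction ℚ => f n)
    (ArithmeticFunction.coe_zeta_mul_coe_moebius (R := ℚ))
  rcases Nat.eq_zero_or_pos n with rfl | hn
  · simp
  have h2 : (coprimeIndicator p * (coprimeIndicator p).pmul ((ArithmeticFunction.moebius :
      ArithmeticFunction ℤ) : ArithmeticFunction ℚ)) n =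
      coprimeIndicator p n * ((ArithmeticFunction.zeta : ArithmeticFunction ℚ) *
        ((ArithmeticFunction.moebius : ArithmeticFunction ℤ) : ArithmeticFunction ℚ)) n := by
    rw [ArithmeticFunction.mul_apply, ArithmeticFunction.mul_apply, Finset.mul_sum]
    refine Finset.sum_congr rfl fun x hx => ?_
    obtain ⟨hxn, -⟩ := Nat.mem_divisorsAntidiagonal.1 hx
    have hx1 : x.1 ≠ 0 := by rintro h; rw [h, zero_mul] at hxn; omega
    rw [ArithmeticFunction.pmul_apply, ← hxn]
    simp only [coprimeIndicator_apply, hp.dvd_mul, ArithmeticFunction.natCoe_apply,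
      ArithmeticFunction.zeta_apply_ne hx1]
    by_cases h1 : p ∣ x.1 <;> by_cases h2 : p ∣ x.2 <;> simp [h1, h2]
  rw [h2]
  rw [show ((ArithmeticFunction.zeta : ArithmeticFunction ℚ) *
    ((ArithmeticFunction.moebius : ArithmeticFunction ℤ) : ArithmeticFunction ℚ)) n = _ from h1]
  by_cases hn1 : n = 1
  · subst hn1
    simp [coprimeIndicator_apply, hp.one_lt.ne']
  · rw [ArithmeticFunction.one_apply_ne hn1, mul_zero]

/-- `n ↦ q ^ n` as an arithmetic function. -/
def powArith (q : ℕ) : ArithmeticFunction ℚ :=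
  ⟨fun n => if n = 0 then 0 else (q : ℚ) ^ n, by simp⟩

theorem powArith_apply {q n : ℕ} (hn : n ≠ 0) : powArith q n = (q : ℚ) ^ n := if_neg hn

theorem mul_traceA_eq {p q i : ℕ} (hi : i ≠ 0) :
    (i : ℚ) * traceA p q i = 1 / q * ((coprimeIndicator p).pmul ((ArithmeticFunction.moebius :
      ArithmeticFunction ℤ) : ArithmeticFunction ℚ) * powArith q) i := by
  have hi' : (i : ℚ) ≠ 0 := Nat.cast_ne_zero.2 hi
  have h : ((coprimeIndicator p).pmul ((ArithmeticFunction.moebius :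
      ArithmeticFunction ℤ) : ArithmeticFunction ℚ) * powArith q) i =
      ∑ k ∈ i.divisors.filter (fun k => ¬ p ∣ k),
      (ArithmeticFunction.moebius k : ℚ) * (q : ℚ) ^ (i / k) := by
    rw [ArithmeticFunction.mul_apply, Nat.sum_divisorsAntidiagonal
      (f := fun x y => (coprimeIndicator p).pmul ((ArithmeticFunction.moebius :
      ArithmeticFunction ℤ) : ArithmeticFunction ℚ) x * powArith q y), Finset.sum_filter]
    refine Finset.sum_congr rfl fun k hk => ?_
    have hk' : i / k ≠ 0 :=
      (Nat.div_pos (Nat.divisor_le hk) (Nat.pos_of_mem_divisors hk)).ne'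
    rw [powArith_apply hk', ArithmeticFunction.pmul_apply, coprimeIndicator_apply]
    by_cases h : p ∣ k <;> simp [h]
  rw [h, traceA, ← mul_assoc, ← mul_div_assoc, mul_one, mul_comm (i : ℚ) q,
    div_mul_cancel_right₀ hi', one_div]

/-- The Möbius-inverted form of the definition of `traceA`. -/
theorem sum_mul_traceA {p q i : ℕ} (hp : p.Prime) (hi : i ≠ 0) :
    ∑ d ∈ i.divisors, (if p ∣ i / d then 0 else (d : ℚ) * traceA p q d) = (q : ℚ) ^ i / q := by
  have h1 : (coprimeIndicator p * ((coprimeIndicator p).pmul ((ArithmeticFunction.moebius :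
      ArithmeticFunction ℤ) : ArithmeticFunction ℚ) * powArith q)) i = (q : ℚ) ^ i := by
    rw [← mul_assoc, coprimeIndicator_mul_moebius hp, one_mul, powArith_apply hi]
  rw [← h1, ArithmeticFunction.mul_apply, ← Nat.sum_divisorsAntidiagonal'
    (f := fun x y => if p ∣ x then 0 else (y : ℚ) * traceA p q y), Finset.sum_div]
  refine Finset.sum_congr rfl fun x hx => ?_
  obtain ⟨hxn, -⟩ := Nat.mem_divisorsAntidiagonal.1 hx
  have hx2 : x.2 ≠ 0 := by rintro h; rw [h, mul_zero] at hxn; omega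
  rw [mul_traceA_eq hx2, coprimeIndicator_apply]
  split_ifs <;> ring

theorem mul_traceA_add_traceB {p q i : ℕ} (hq : q ≠ 0) (hi : i ≠ 0) :
    (i : ℚ) * (q * traceA p q i + traceB p q i) =
      ∑ k ∈ i.divisors, (ArithmeticFunction.moebius k : ℚ) * (q : ℚ) ^ (i / k) := by
  have hi' : (i : ℚ) ≠ 0 := Nat.cast_ne_zero.2 hi
  have hq' : (q : ℚ) ≠ 0 := Nat.cast_ne_zero.2 hq
  rw [traceA, traceB, ← Finset.sum_filter_add_sum_filter_not i.divisors (fun k => p ∣ k)]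
  field_simp
  ring

/-! ### Counting irreducible polynomials by trace. -/

section FieldExtension

variable {F : Type*} [Field F] [Finite F]

/-- The degree condition embeds `AdjoinRoot f` in `K`, so `f` has a root there. By normality it
splits, by separability its roots are distinct, and these roots are the elements with minimal
polynomial `f`. -/
theorem card_minpoly_fiber {K : Type*} [Field K] [Fintype K] [Algebra F K] [DecidableEq F[X]]
    {f : F[X]} (hf : f.Monic) (hi : Irreducible f) (hd : f.natDegree ∣ Module.finrank F K) :
    (Finset.univ.filter fun x : K => minpoly F x = f).card = f.natDegree := by
  have : Module.Finite F K := Module.Finite.of_finite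
  have : Fact (Irreducible f) := ⟨hi⟩
  have hsep : f.Separable := PerfectField.separable_of_irreducible hi
  let A := AdjoinRoot f
  have : Module.Finite F A := hf.finite_adjoinRoot
  have : Finite A := Module.finite_of_finite F
  have hA : Module.finrank F A = f.natDegree := by
    rw [(AdjoinRoot.powerBasis hi.ne_zero).finrank, AdjoinRoot.powerBasis_dim]
  obtain ⟨φ⟩ := FiniteField.nonempty_algHom_of_finrank_dvd (F := F) (K := A) (L := K)
    (by rwa [hA])
  have hroot : aeval (φ (AdjoinRoot.root f)) f = 0 := by
    rw [aeval_algHom_apply, AdjoinRoot.aeval_eq, AdjoinRoot.mk_self, map_zero]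
  have hmin : minpoly F (φ (AdjoinRoot.root f)) = f :=
    (minpoly.eq_of_irreducible_of_monic hi hroot hf).symm
  have hsplit : (f.map (algebraMap F K)).Splits := by
    rw [← hmin]
    exact Normal.splits inferInstance _
  rw [← card_rootSet_eq_natDegree hsep hsplit, ← Set.toFinset_card]
  congr 1
  ext x
  rw [Finset.mem_filter, Set.mem_toFinset, mem_rootSet]
  constructor
  · rintro ⟨-, rfl⟩
    exact ⟨hi.ne_zero, minpoly.aeval F x⟩
  · rintro ⟨-, h⟩
    exact ⟨Finset.mem_univ _, (minpoly.eq_of_irreducible_of_monic hi h hf).symm⟩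

/-- Summing a function of the trace over a field extension of degree `n` by means of the minimal
polynomials. -/
theorem sum_trace_eq_sum_monicIrreducibles {K : Type*} [Field K] [Fintype K] [Algebra F K]
    (w : F → ℚ) :
    ∑ x : K, w (Algebra.trace F K x) = ∑ d ∈ (Module.finrank F K).divisors,
      ∑ f ∈ monicIrreduciblesFinset F d,
        (d : ℚ) * w (((Module.finrank F K / d : ℕ) : F) * -f.nextCoeff) := by
  classical
  have : Module.Finite F K := Module.Finite.of_finite
  have hpos : 0 < Module.finrank F K := Module.finrank_pos
  rw [← Finset.sum_fiberwise_of_maps_to (s := Finset.univ)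
    (t := (Module.finrank F K).divisors) (g := fun x : K => (minpoly F x).natDegree)]
  · refine Finset.sum_congr rfl fun d hd => ?_
    rw [← Finset.sum_fiberwise_of_maps_to (t := monicIrreduciblesFinset F d)
      (g := fun x : K => minpoly F x)]
    · refine Finset.sum_congr rfl fun f hf => ?_
      obtain ⟨h1, h2, h3⟩ := mem_monicIrreduciblesFinset.1 hf
      rw [Finset.sum_congr rfl (g := fun _ => w (((Module.finrank F K / d : ℕ) : F) * -f.nextCoeff)),
        Finset.sum_const, Finset.filter_filter, nsmul_eq_mul]
      · congr 1
        rw [← h3, ← card_minpoly_fiber (K := K) h1 h2 (h3 ▸ Nat.dvd_of_mem_divisors hd)]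
        congr 2
        refine Finset.filter_congr fun x _ => ⟨fun h => h.2, fun h => ⟨?_, h⟩⟩
        rw [h, card_minpoly_fiber h1 h2 (h3 ▸ Nat.dvd_of_mem_divisors hd)]
      · intro x hx
        rw [Finset.mem_filter] at hx
        rw [trace_eq_finrank_mul_minpoly_nextCoeff, hx.2]
        congr 3
        have h4 : Module.finrank F (IntermediateField.adjoin F {x}) = d := by
          rw [IntermediateField.adjoin.finrank (Algebra.IsIntegral.isIntegral x), hx.2, h3]
        have h5 := Module.finrank_mul_finrank F (IntermediateField.adjoin F {x}) K
        rw [h4] at h5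
        rw [← h5, Nat.mul_div_cancel_left _ (Nat.pos_of_mem_divisors hd)]
    · intro x hx
      have hx' := Algebra.IsIntegral.isIntegral (R := F) x
      exact mem_monicIrreduciblesFinset.2 ⟨minpoly.monic hx', minpoly.irreducible hx',
        (Finset.mem_filter.1 hx).2⟩
  · intro x _
    exact Nat.mem_divisors.2
      ⟨minpoly.degree_dvd (Algebra.IsIntegral.isIntegral x), hpos.ne'⟩

/-- The trace is a surjective additive homomorphism, so its fibers all have the same size. -/
theorem natCard_mul_card_trace_fiber {K : Type*} [Field K] [Fintype K] [Algebra F K]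
    [DecidableEq F] (t : F) :
    Nat.card F * (Finset.univ.filter fun x : K => Algebra.trace F K x = t).card =
      Nat.card F ^ Module.finrank F K := by
  have := Fintype.ofFinite F
  have : Module.Finite F K := Module.Finite.of_finite
  have hs := Algebra.trace_surjective F K
  rw [← Module.natCard_eq_pow_finrank (K := F) (V := K), Nat.card_eq_fintype_card (α := K),
    ← Finset.card_univ,
    Finset.card_eq_sum_card_fiberwise (s := (Finset.univ : Finset K)) (f := Algebra.trace F K)
      (t := Finset.univ) (by simp),
    Finset.sum_congr rfl fun s _ => AddMonoidHom.card_fiber_eq_of_mem_range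
      (Algebra.trace F K) (hs s) (hs t), Finset.sum_const, Finset.card_univ,
    Nat.card_eq_fintype_card, smul_eq_mul]

/-- The number of monic irreducible polynomials with prescribed nonzero trace. -/
theorem card_monicIrreducibles_nextCoeff_ne_zero [DecidableEq F] (p : ℕ) [CharP F p] {i : ℕ}
    (hi : i ≠ 0) {c : F} (hc : c ≠ 0) :
    (((monicIrreduciblesFinset F i).filter fun f => f.nextCoeff = c).card : ℚ) =
      traceA p (Nat.card F) i := by
  have := Fintype.ofFinite F
  have hp : Fact p.Prime := ⟨CharP.char_is_prime F p⟩
  induction i using Nat.strong_induction_on generalizing c with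
  | _ i ih =>
    have : NeZero i := ⟨hi⟩
    have := Fintype.ofFinite (FiniteField.Extension F p i)
    -- The target is `-c` because `nextCoeff` is minus the sum of the roots.
    have h1 := sum_trace_eq_sum_monicIrreducibles (F := F) (K := FiniteField.Extension F p i)
      (fun t => if t = -c then 1 else 0)
    rw [FiniteField.finrank_extension] at h1
    have h2 := natCard_mul_card_trace_fiber (K := FiniteField.Extension F p i) (-c)
    rw [FiniteField.finrank_extension] at h2
    have hq : (Nat.card F : ℚ) ≠ 0 := Nat.cast_ne_zero.2 Nat.card_pos.ne'
    rw [Finset.sum_boole] at h1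
    have h3 : ∑ d ∈ i.divisors, (∑ f ∈ monicIrreduciblesFinset F d,
        (d : ℚ) * if ((i / d : ℕ) : F) * -f.nextCoeff = -c then (1 : ℚ) else 0) =
        ∑ d ∈ i.divisors, (if p ∣ i / d then 0 else (d : ℚ) * traceA p (Nat.card F) d) := by
      rw [← h1, sum_mul_traceA hp.out hi, eq_div_iff hq, mul_comm]
      exact_mod_cast h2
    -- If `p ∣ i / d` the trace is 0 and misses `-c`; otherwise `i / d` is invertible in `F` and
    -- only rescales `c`. This is why the induction generalizes `c`.
    have h4 : ∀ d, (∑ f ∈ monicIrreduciblesFinset F d,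
        (d : ℚ) * if ((i / d : ℕ) : F) * -f.nextCoeff = -c then (1 : ℚ) else 0) =
        if p ∣ i / d then 0 else (d : ℚ) * ((monicIrreduciblesFinset F d).filter
          fun f => f.nextCoeff = c / ((i / d : ℕ) : F)).card := by
      intro d
      rw [← Finset.mul_sum, Finset.sum_boole]
      split_ifs with h
      · rw [(CharP.cast_eq_zero_iff F p _).2 h]
        simp [hc]
      · have h5 : ((i / d : ℕ) : F) ≠ 0 := fun h6 => h ((CharP.cast_eq_zero_iff F p _).1 h6)
        congr 3
        refine Finset.filter_congr fun f _ => ?_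
        rw [mul_neg, neg_inj, eq_div_iff h5, mul_comm]
    simp_rw [h4] at h3
    -- The counts and `traceA` satisfy the same divisor-sum relation; the proper divisors cancel by
    -- induction, leaving the term `d = i`.
    have hmem : i ∈ i.divisors := Nat.mem_divisors_self i hi
    rw [← Finset.add_sum_erase _ _ hmem, ← Finset.add_sum_erase _ _ hmem] at h3
    have h6 : ∀ d ∈ i.divisors.erase i, (if p ∣ i / d then 0 else
        (d : ℚ) * ((monicIrreduciblesFinset F d).filter
          fun f => f.nextCoeff = c / ((i / d : ℕ) : F)).card) =
        (if p ∣ i / d then 0 else (d : ℚ) * traceA p (Nat.card F) d) := by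
      intro d hd
      rw [Finset.mem_erase] at hd
      split_ifs with h
      · rfl
      · have h5 : ((i / d : ℕ) : F) ≠ 0 := fun h6 => h ((CharP.cast_eq_zero_iff F p _).1 h6)
        rw [ih d (lt_of_le_of_ne (Nat.divisor_le hd.2) hd.1) (Nat.pos_of_mem_divisors hd.2).ne'
          (div_ne_zero hc h5)]
    rw [Finset.sum_congr rfl h6, add_left_inj, Nat.div_self (Nat.pos_of_ne_zero hi),
      if_neg hp.out.not_dvd_one, if_neg hp.out.not_dvd_one, Nat.cast_one, div_one] at h3
    exact mul_left_cancel₀ (Nat.cast_ne_zero.2 hi) h3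

/-- Gauss's formula for the number of monic irreducible polynomials, in terms of `traceA` and
`traceB`. -/
theorem card_monicIrreducibles_eq (p : ℕ) [CharP F p] {i : ℕ} (hi : i ≠ 0) :
    ((monicIrreduciblesFinset F i).card : ℚ) =
      Nat.card F * traceA p (Nat.card F) i + traceB p (Nat.card F) i := by
  have hp : Fact p.Prime := ⟨CharP.char_is_prime F p⟩
  have h : ∀ n : ℕ, n > 0 → ∑ d ∈ n.divisors, (d : ℚ) * (monicIrreduciblesFinset F d).card =
      (Nat.card F : ℚ) ^ n := by
    intro n hn
    have : NeZero n := ⟨hn.ne'⟩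
    have := Fintype.ofFinite (FiniteField.Extension F p n)
    -- With constant weight 1 this merely counts the extension, giving Gauss's relation ∑ d |I_d| =
    -- q^n.
    have h1 := sum_trace_eq_sum_monicIrreducibles (F := F) (K := FiniteField.Extension F p n)
      (fun t => 1)
    rw [FiniteField.finrank_extension] at h1
    simp only [Finset.sum_const, Finset.card_univ, nsmul_eq_mul, mul_one] at h1
    rw [← Nat.card_eq_fintype_card, FiniteField.natCard_extension] at h1
    push_cast at h1
    rw [h1]
    exact Finset.sum_congr rfl fun d _ => mul_comm _ _
  have h2 := ArithmeticFunction.sum_eq_iff_sum_mul_moebius_eq.1 h i (Nat.pos_of_ne_zero hi)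
  rw [Nat.sum_divisorsAntidiagonal (f := fun x y => ((ArithmeticFunction.moebius x : ℤ) : ℚ) *
    (Nat.card F : ℚ) ^ y), ← mul_traceA_add_traceB (p := p) Nat.card_pos.ne' hi] at h2
  exact (mul_left_cancel₀ (Nat.cast_ne_zero.2 hi) h2).symm

/-- The number of monic irreducible polynomials with trace zero. -/
theorem card_monicIrreducibles_nextCoeff_zero [DecidableEq F] (p : ℕ) [CharP F p] {i : ℕ}
    (hi : i ≠ 0) :
    (((monicIrreduciblesFinset F i).filter fun f => f.nextCoeff = 0).card : ℚ) =
      traceA p (Nat.card F) i + traceB p (Nat.card F) i := by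
  have := Fintype.ofFinite F
  have h1 := Finset.card_eq_sum_card_fiberwise (s := monicIrreduciblesFinset F i)
    (t := Finset.univ) (f := nextCoeff) (by simp)
  have h2 := card_monicIrreducibles_eq (F := F) p hi
  rw [h1, Nat.cast_sum, ← Finset.add_sum_erase _ _ (Finset.mem_univ (0 : F)),
    Finset.sum_congr rfl fun c hc => card_monicIrreducibles_nextCoeff_ne_zero p hi
      (Finset.ne_of_mem_erase hc), Finset.sum_const, Finset.card_erase_of_mem (Finset.mem_univ _),
    Finset.card_univ, ← Nat.card_eq_fintype_card, nsmul_eq_mul, Nat.cast_pred Nat.card_pos] at h2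
  linarith

end FieldExtension

/-! ### Unique factorization as a bijection with exponent families. -/

theorem AddChar.map_multiset_sum {A R : Type*} [AddCommMonoid A] [CommMonoid R]
    (χ : AddChar A R) (s : Multiset A) : χ s.sum = (s.map χ).prod := by
  induction s using Multiset.induction_on with
  | empty => simp
  | cons a s ih => rw [Multiset.sum_cons, AddChar.map_add_eq_mul, ih, Multiset.map_cons,
      Multiset.prod_cons]

section Pattern

variable {F : Type*} [Field F] [DecidableEq F[X]] {T : Finset ℕ} {l : T → ℕ}

/-- The multiset of polynomials with the given exponents. -/
def multisetOfExponents (x : T → F[X] →₀ ℕ) : Multiset F[X] :=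
  ∑ i, Finsupp.toMultiset (x i)

theorem count_multisetOfExponents (x : T → F[X] →₀ ℕ) (f : F[X]) :
    (multisetOfExponents x).count f = ∑ i, x i f := by
  rw [multisetOfExponents, Multiset.count_sum']
  simp [Finsupp.count_toMultiset]

/-- The exponents of the monic irreducible factors of a polynomial, sorted by degree. -/
def exponentsOfPoly (T : Finset ℕ) (g : F[X]) : T → F[X] →₀ ℕ :=
  fun i => Multiset.toFinsupp ((monicFactors g).filter fun f => f.natDegree = (i : ℕ))

theorem multisetOfExponents_exponentsOfPoly {g : F[X]}
    (h : ∀ f ∈ monicFactors g, f.natDegree ∈ T) :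
    multisetOfExponents (exponentsOfPoly T g) = monicFactors g := by
  ext f
  rw [count_multisetOfExponents]
  simp only [exponentsOfPoly, Multiset.toFinsupp_apply, Multiset.count_filter]
  rw [Finset.sum_coe_sort T fun i => if f.natDegree = i then (monicFactors g).count f else 0,
    Finset.sum_ite_eq]
  split_ifs with hf
  · rfl
  · exact (Multiset.count_eq_zero.2 fun h1 => hf (h f h1)).symm

variable [Finite F]

/-- The families of exponents on the monic irreducible polynomials of degree `i ∈ T` with total
exponent `l i` in degree `i`. -/
def exponentFamilies (F : Type*) [Field F] [Finite F] [DecidableEq F[X]] {T : Finset ℕ}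
    (l : T → ℕ) : Finset (T → F[X] →₀ ℕ) :=
  Fintype.piFinset fun i : T => (monicIrreduciblesFinset F i).finsuppAntidiag (l i)

theorem mem_of_exponent_ne_zero {x : T → F[X] →₀ ℕ} (hx : x ∈ exponentFamilies F l)
    {i : T} {f : F[X]} (h : x i f ≠ 0) : f ∈ monicIrreduciblesFinset F i :=
  (Finset.mem_finsuppAntidiag.1 (Fintype.mem_piFinset.1 hx i)).2 (Finsupp.mem_support_iff.2 h)

theorem filter_multisetOfExponents {x : T → F[X] →₀ ℕ} (hx : x ∈ exponentFamilies F l) (i : T) :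
    ((multisetOfExponents x).filter fun f => f.natDegree = (i : ℕ)) = Finsupp.toMultiset (x i) := by
  ext f
  rw [Multiset.count_filter, count_multisetOfExponents, Finsupp.count_toMultiset]
  split_ifs with h
  · refine Finset.sum_eq_single i (fun j _ hj => ?_) (by simp)
    by_contra h0
    have := (mem_monicIrreduciblesFinset.1 (mem_of_exponent_ne_zero hx h0)).2.2
    exact hj (Subtype.ext (this.symm.trans h))
  · by_contra h0
    exact h (mem_monicIrreduciblesFinset.1 (mem_of_exponent_ne_zero hx (Ne.symm h0))).2.2

theorem exists_mem_of_mem_multisetOfExponents {x : T → F[X] →₀ ℕ} (hx : x ∈ exponentFamilies F l)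
    {f : F[X]} (hf : f ∈ multisetOfExponents x) : ∃ i : T, f ∈ monicIrreduciblesFinset F i := by
  rw [← Multiset.count_ne_zero, count_multisetOfExponents] at hf
  obtain ⟨i, -, hi⟩ := Finset.exists_ne_zero_of_sum_ne_zero hf
  exact ⟨i, mem_of_exponent_ne_zero hx hi⟩

theorem monicFactors_prod_multisetOfExponents {x : T → F[X] →₀ ℕ}
    (hx : x ∈ exponentFamilies F l) :
    monicFactors (multisetOfExponents x).prod = multisetOfExponents x :=
  monicFactors_prod fun f hf => by
    obtain ⟨i, hi⟩ := exists_mem_of_mem_multisetOfExponents hx hf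
    rw [mem_monicIrreduciblesFinset] at hi
    exact ⟨hi.1, hi.2.1⟩

theorem monic_prod_multisetOfExponents {x : T → F[X] →₀ ℕ} (hx : x ∈ exponentFamilies F l) :
    (multisetOfExponents x).prod.Monic := by
  rw [← Multiset.map_id (multisetOfExponents x)]
  refine monic_multiset_prod_of_monic _ _ fun f hf => ?_
  obtain ⟨i, hi⟩ := exists_mem_of_mem_multisetOfExponents hx hf
  exact (mem_monicIrreduciblesFinset.1 hi).1

theorem irreducibleFactorCount_prod_multisetOfExponents {x : T → F[X] →₀ ℕ}
    (hx : x ∈ exponentFamilies F l) (i : T) :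
    irreducibleFactorCount i (multisetOfExponents x).prod = l i := by
  rw [irreducibleFactorCount_eq_card_filter (monic_prod_multisetOfExponents hx).ne_zero,
    monicFactors_prod_multisetOfExponents hx, filter_multisetOfExponents hx,
    Finsupp.card_toMultiset]
  obtain ⟨h1, h2⟩ := Finset.mem_finsuppAntidiag.1 (Fintype.mem_piFinset.1 hx i)
  rw [← h1]
  exact Finsupp.sum_of_support_subset _ h2 _ (by simp)

theorem exponentsOfPoly_mem {g : F[X]} (hg : g.Monic)
    (h : ∀ i : T, irreducibleFactorCount i g = l i) :
    exponentsOfPoly T g ∈ exponentFamilies F l := by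
  refine Fintype.mem_piFinset.2 fun i => Finset.mem_finsuppAntidiag.2 ?_
  have hs : (exponentsOfPoly T g i).support ⊆ monicIrreduciblesFinset F i := by
    intro f hf
    rw [exponentsOfPoly, Multiset.toFinsupp_support, Multiset.mem_toFinset, Multiset.mem_filter,
      mem_monicFactors hg.ne_zero] at hf
    exact mem_monicIrreduciblesFinset.2 ⟨hf.1.1, hf.1.2.1, hf.2⟩
  refine ⟨?_, hs⟩
  rw [← h i, irreducibleFactorCount_eq_card_filter hg.ne_zero, ← Multiset.toFinsupp_sum_eq]
  exact (Finsupp.sum_of_support_subset (exponentsOfPoly T g i) hs (fun _ => id) (by simp)).symm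

theorem exponentsOfPoly_prod {x : T → F[X] →₀ ℕ} (hx : x ∈ exponentFamilies F l) :
    exponentsOfPoly T (multisetOfExponents x).prod = x := by
  funext i
  rw [exponentsOfPoly, monicFactors_prod_multisetOfExponents hx, filter_multisetOfExponents hx,
    Finsupp.toMultiset_toFinsupp]

/-- For monic polynomials `nextCoeff` of a product is the sum of the `nextCoeff`s, and `χ` turns
this sum into a product. -/
theorem map_nextCoeff_prod_multisetOfExponents (χ : AddChar F ℂ) {x : T → F[X] →₀ ℕ}
    (hx : x ∈ exponentFamilies F l) :
    χ (multisetOfExponents x).prod.nextCoeff =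
      ∏ i : T, ∏ f ∈ monicIrreduciblesFinset F i, χ f.nextCoeff ^ x i f := by
  rw [← Multiset.map_id (multisetOfExponents x), Monic.nextCoeff_multiset_prod _ _ fun f hf => by
      obtain ⟨i, hi⟩ := exists_mem_of_mem_multisetOfExponents hx hf
      exact (mem_monicIrreduciblesFinset.1 hi).1,
    AddChar.map_multiset_sum, Multiset.map_map, multisetOfExponents]
  have h1 : ∀ M : T → Multiset F[X], ((∑ i, M i).map (χ ∘ fun f => (id f).nextCoeff)).prod =
      ∏ i, ((M i).map (χ ∘ fun f => (id f).nextCoeff)).prod := by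
    intro M
    rw [← Multiset.coe_mapAddMonoidHom, map_sum, Multiset.prod_sum]
  rw [h1]
  refine Finset.prod_congr rfl fun i _ => ?_
  rw [Finsupp.toMultiset_map, Finsupp.prod_toMultiset, Finsupp.prod_mapDomain_index (by simp)
    (fun _ _ _ => pow_add _ _ _)]
  exact Finsupp.prod_of_support_subset _
    (Finset.mem_finsuppAntidiag.1 (Fintype.mem_piFinset.1 hx i)).2 _ (by simp)

end Pattern

/-! ### Character sums over a factorization pattern. -/

/-- Expanding the geometric series gives a sum over exponent families, which correspond to the
polynomials `g` by unique factorization. The hypothesis `hl` excludes factors of degree above `n`,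
which the pattern itself does not control. -/
theorem sum_factorPatternFinset_addChar {F : Type*} [Field F] [Finite F] {n m : ℕ}
    {l : Finset.Icc 1 n → ℕ} (hl : ∑ i : Finset.Icc 1 n, (i : ℕ) * l i = m) (χ : AddChar F ℂ) :
    ∑ g ∈ factorPatternFinset F m l, χ g.nextCoeff =
      ∏ i : Finset.Icc 1 n, PowerSeries.coeff (l i)
        (∏ f ∈ monicIrreduciblesFinset F i, geomSeries (χ f.nextCoeff)) := by
  classical
  simp_rw [PowerSeries.coeff_prod, geomSeries, PowerSeries.coeff_mk]
  rw [Finset.prod_univ_sum]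
  symm
  refine Finset.sum_nbij' (t := factorPatternFinset F m l)
    (fun x => (multisetOfExponents x).prod) (exponentsOfPoly (Finset.Icc 1 n)) ?_ ?_ ?_ ?_ ?_
  · intro x hx
    have h1 := monic_prod_multisetOfExponents hx
    have h2 := irreducibleFactorCount_prod_multisetOfExponents hx
    refine mem_factorPatternFinset.2 ⟨h1, ?_, h2⟩
    have h3 : IsSmoothPoly n (multisetOfExponents x).prod := by
      rw [isSmoothPoly_iff_monicFactors h1.ne_zero, monicFactors_prod_multisetOfExponents hx]
      intro f hf
      obtain ⟨i, hi⟩ := exists_mem_of_mem_multisetOfExponents hx hf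
      rw [(mem_monicIrreduciblesFinset.1 hi).2.2]
      exact (Finset.mem_Icc.1 i.2).2
    rw [isSmoothPoly_iff_sum_irreducibleFactorCount h1] at h3
    rw [← h3, ← hl]
    simp_rw [h2]
  · intro g hg
    rw [mem_factorPatternFinset] at hg
    exact exponentsOfPoly_mem hg.1 hg.2.2
  · intro x hx
    exact exponentsOfPoly_prod hx
  · intro g hg
    rw [mem_factorPatternFinset] at hg
    have h1 : IsSmoothPoly n g := by
      rw [isSmoothPoly_iff_sum_irreducibleFactorCount hg.1, hg.2.1, ← hl]
      simp_rw [hg.2.2]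
    rw [isSmoothPoly_iff_monicFactors hg.1.ne_zero] at h1
    rw [multisetOfExponents_exponentsOfPoly fun f hf => Finset.mem_Icc.2
      ⟨natDegree_pos_of_mem_monicFactors hg.1.ne_zero hf, h1 f hf⟩, prod_monicFactors hg.1]
  · intro x hx
    exact (map_nextCoeff_prod_multisetOfExponents χ hx).symm

theorem coeff_prod_geomSeries_zero {F : Type*} [Field F] [Finite F] (i l : ℕ) :
    PowerSeries.coeff l (∏ f ∈ monicIrreduciblesFinset F i,
      geomSeries ((0 : AddChar F ℂ) f.nextCoeff)) =
      (((monicIrreducibles F i).ncard + l - 1).choose l : ℂ) := by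
  simp_rw [AddChar.zero_apply]
  rw [Finset.prod_const, geomSeries_one_pow, coeff_negBinomialSeries, ncard_monicIrreducibles]
  -- For `l = 0` the natural subtraction may truncate, but both binomials are then 1.
  rcases Nat.eq_zero_or_pos l with rfl | hl
  · simp
  · rw [← Nat.cast_add, ← Nat.cast_pred (by omega), Ring.choose_natCast, Rat.cast_natCast]

theorem coeff_prod_geomSeries_ne_zero {F : Type*} [Field F] [Finite F] (p : ℕ) [CharP F p]
    {χ : AddChar F ℂ} (hχ : χ ≠ 0) {i : ℕ} (hi : i ≠ 0) (l : ℕ) :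
    PowerSeries.coeff l (∏ f ∈ monicIrreduciblesFinset F i, geomSeries (χ f.nextCoeff)) =
      ((coeffB p (Nat.card F) l (traceA p (Nat.card F) i) (traceB p (Nat.card F) i) : ℚ) : ℂ) := by
  classical
  have := Fintype.ofFinite F
  have hp : Fact p.Prime := ⟨CharP.char_is_prime F p⟩
  have hpq : p ∣ Fintype.card F := by
    rw [← CharP.cast_eq_zero_iff F p, Nat.cast_card_eq_zero]
  obtain ⟨k, hk⟩ := hpq
  set N : F → ℕ := fun c => ((monicIrreduciblesFinset F i).filter fun f => f.nextCoeff = c).card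
  have hN : ∀ c, c ≠ 0 → (N c : ℚ) = traceA p (Nat.card F) i := fun c hc =>
    card_monicIrreducibles_nextCoeff_ne_zero p hi hc
  have hN1 : ∀ c, c ≠ 0 → N c = N 1 := fun c hc => by
    have := (hN c hc).trans (hN 1 one_ne_zero).symm
    exact_mod_cast this
  have h0 : (N 0 : ℚ) = N 1 + traceB p (Nat.card F) i := by
    rw [hN 1 one_ne_zero]
    exact card_monicIrreducibles_nextCoeff_zero p hi
  have h1 : ∏ f ∈ monicIrreduciblesFinset F i, geomSeries (χ f.nextCoeff) =
      ∏ c : F, geomSeries (χ c) ^ N c := by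
    rw [← Finset.prod_fiberwise_of_maps_to (t := Finset.univ) (g := nextCoeff) (by simp)]
    refine Finset.prod_congr rfl fun c _ => ?_
    rw [Finset.prod_congr rfl (g := fun _ => geomSeries (χ c)), Finset.prod_const]
    intro f hf
    rw [(Finset.mem_filter.1 hf).2]
  -- All exponents equal `N 1` except at `c = 0`, where χ(0) = 1 and the discrepancy b_i becomes a
  -- power of 1 - X. As b_i can be negative, the binomial series is needed here.
  have h2 : ∏ c : F, geomSeries (χ c) ^ N c =
      (∏ c : F, geomSeries (χ c)) ^ N 1 * negBinomialSeries (traceB p (Nat.card F) i) := by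
    rw [← Finset.prod_pow, ← Finset.mul_prod_erase _ _ (Finset.mem_univ (0 : F)),
      ← Finset.mul_prod_erase _ (fun c => geomSeries (χ c) ^ N 1) (Finset.mem_univ (0 : F)),
      Finset.prod_congr rfl fun c hc => by rw [hN1 c (Finset.ne_of_mem_erase hc)],
      AddChar.map_zero_eq_one, geomSeries_one_pow, geomSeries_one_pow, h0, negBinomialSeries_add]
    ring
  have h3 : negBinomialSeries k ^ N 1 =
      negBinomialSeries (traceA p (Nat.card F) i * (Nat.card F : ℕ) / p) := by
    rw [← geomSeries_one_pow, ← pow_mul, geomSeries_one_pow, ← hN 1 one_ne_zero,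
      Nat.card_eq_fintype_card, hk]
    have hp0 : (p : ℚ) ≠ 0 := Nat.cast_ne_zero.2 hp.out.ne_zero
    congr 1
    push_cast
    field_simp
  rw [h1, h2, prod_geomSeries_addChar p hχ hk, ← map_pow, h3,
    coeff_expand_mul_negBinomialSeries]

theorem natCard_mul_factorPatternCount {F : Type*} [Field F] [Finite F] (p : ℕ) [CharP F p]
    {n m : ℕ} {l : Finset.Icc 1 n → ℕ} (hl : l ∈ weightedTuples n m) (α : F) :
    (Nat.card F : ℚ) * factorPatternCount m l 1 (X + C α) =
      ∏ i : Finset.Icc 1 n, (((monicIrreducibles F i).ncard + l i - 1).choose (l i) : ℚ) +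
      traceV α * ∏ i : Finset.Icc 1 n,
        coeffB p (Nat.card F) (l i) (traceA p (Nat.card F) i) (traceB p (Nat.card F) i) := by
  classical
  have := Fintype.ofFinite F
  rw [mem_weightedTuples] at hl
  have h1 : ((Nat.card F : ℚ) * factorPatternCount m l 1 (X + C α) : ℂ) =
      ∑ χ : AddChar F ℂ, χ (-α) * ∑ g ∈ factorPatternFinset F m l, χ g.nextCoeff := by
    simp_rw [Finset.mul_sum]
    rw [Finset.sum_comm]
    simp_rw [← AddChar.map_add_eq_mul, AddChar.sum_apply_eq_ite, neg_add_eq_zero]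
    rw [factorPatternCount_one_eq_card, ← Finset.sum_filter, Finset.sum_const, nsmul_eq_mul,
      Nat.card_eq_fintype_card, mul_comm]
    simp_rw [eq_comm (a := α)]
    norm_cast
  -- The sum over all characters is q or 0 according to whether α = 0; dropping the trivial one
  -- subtracts 1.
  have h2 : ∑ χ ∈ Finset.univ.erase (0 : AddChar F ℂ), χ (-α) = ((traceV α : ℚ) : ℂ) := by
    have h3 := AddChar.sum_apply_eq_ite (-α)
    rw [← Finset.add_sum_erase _ _ (Finset.mem_univ (0 : AddChar F ℂ)), AddChar.zero_apply] at h3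
    rw [eq_sub_of_add_eq' h3, traceV, Nat.card_eq_fintype_card]
    simp only [neg_eq_zero]
    split_ifs <;> push_cast <;> rfl
  rw [← Finset.add_sum_erase _ _ (Finset.mem_univ (0 : AddChar F ℂ)), AddChar.zero_apply, one_mul,
    sum_factorPatternFinset_addChar hl, Finset.prod_congr rfl fun (i : Finset.Icc 1 n) _ =>
      coeff_prod_geomSeries_zero (F := F) (i : ℕ) (l i)] at h1
  have h4 : ∀ χ ∈ Finset.univ.erase (0 : AddChar F ℂ),
      χ (-α) * ∑ g ∈ factorPatternFinset F m l, χ g.nextCoeff = χ (-α) *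
        ((∏ i : Finset.Icc 1 n, coeffB p (Nat.card F) (l i) (traceA p (Nat.card F) i)
          (traceB p (Nat.card F) i) : ℚ) : ℂ) := by
    intro χ hχ
    rw [sum_factorPatternFinset_addChar hl, Rat.cast_prod]
    congr 1
    refine Finset.prod_congr rfl fun i _ => ?_
    exact coeff_prod_geomSeries_ne_zero p (Finset.ne_of_mem_erase hχ)
      (Nat.one_le_iff_ne_zero.1 (Finset.mem_Icc.1 i.2).1) (l i)
  rw [Finset.sum_congr rfl h4, ← Finset.sum_mul, h2] at h1
  exact_mod_cast h1

end

theorem corollary7p9 {F : Type*} [Field F] [Finite F] (p : ℕ) [CharP F p]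
    (q : ℕ) (hq : q = Nat.card F) (n m : ℕ) (α : F) :
    (1 ≤ m →
      {f : F[X] | (∃ g : F[X], g.degree < ((m - 1 : ℕ) : WithBot ℕ) ∧
          f = X ^ m + C α * X ^ (m - 1) + g) ∧ IsSmoothPoly n f}.ncard =
        ∑ l ∈ weightedTuples n m, factorPatternCount m l 1 (X + C α)) ∧
    ((∑ l ∈ weightedTuples n m, factorPatternCount m l 1 (X + C α) : ℕ) : ℚ) =
      1 / (q : ℚ) * ∑ l ∈ weightedTuples n m, ∏ i : Finset.Icc 1 n,
          (((monicIrreducibles F i).ncard + l i - 1).choose (l i) : ℚ) +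
      traceV α / (q : ℚ) * ∑ l ∈ weightedTuples n m, ∏ i : Finset.Icc 1 n,
          coeffB p q (l i) (traceA p q i) (traceB p q i) := by
  subst hq
  refine ⟨fun hm => ncard_smooth_eq_sum_factorPatternCount hm n α, ?_⟩
  have hq : (Nat.card F : ℚ) ≠ 0 := Nat.cast_ne_zero.2 Nat.card_pos.ne'
  refine mul_left_cancel₀ hq ?_
  rw [Nat.cast_sum, Finset.mul_sum,
    Finset.sum_congr rfl fun l hl => natCard_mul_factorPatternCount p hl α,
    Finset.sum_add_distrib, ← Finset.mul_sum]
  field_simp
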